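/- Let $d,W\ge 1$ be integers and let $D=D_{d,W}=\#\{k\in\mathbb{Z}^d: 1\le \|k\|_2\le W\}$, the common vertex degree of the graph on $\mathbb{Z}^d$ in which $x\sim y$ iff $1\le\|x-y\|_2\le W$ (so $D=2dW$ if $d=1$ or $W=1$); here $\|\cdot\|_2$ is the Euclidean norm. For an integer $N\ge 1$ let $\Lambda=\{1,\dots,N\}^d$, and for real numbers $a_{ij}=a_{ji}\in[0,1]$ ($i,j\in\Lambda$) let $H=H^d_{N,W}=(h_{ij})_{i,j\in\Lambda}$ be the $N^d\times N^d$ real symmetric matrix with $$h_{ii}=D,\qquad h_{ij}=-a_{ij}\ \text{ if } 1\le\|i-j\|_2\le W,\qquad h_{ij}=0\ \text{ otherwise}.$$ Let $\lambda^d_{N,W}$ be the ground state energy of $H$, that is, its smallest eigenvalue. Then there is a constant $C=C(d,W)<\infty$, depending only on $d$ and $W$, such that for every $N\ge 1$ and every choice of the symmetric hopping values $a_{ij}=a_{ji}\in[0,1]$, the matrix $H$ is invertible, the landscape function $u^d_{N,W}=H^{-1}\mathbb{1}$ is strictly positive on $\Lambda$, and $$1\ \le\ \lambda^d_{N,W}\,\|u^d_{N,W}\|_{\ell^\infty(\Lambda)}\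 \le\ C .$$ -/

import Mathlib

/-- The Euclidean norm of a lattice vector `k ∈ ℤ^d`. -/
noncomputable def latticeNorm {d : ℕ} (k : Fin d → ℤ) : ℝ :=
  ‖(WithLp.toLp 2 (fun i => (k i : ℝ)) : EuclideanSpace ℝ (Fin d))‖

/-- The box `Λ = {1, …, N}^d` in `ℤ^d`. -/
noncomputable def latticeBox (d N : ℕ) : Finset (Fin d → ℤ) :=
  Finset.Icc (fun _ => 1) (fun _ => (N : ℤ))

/-- The lattice vectors `k` with `1 ≤ ‖k‖₂ ≤ W`: these are the neighbours of the origin in the graph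
on `ℤ^d` in which `x ∼ y` iff `1 ≤ ‖x - y‖₂ ≤ W`. -/
def bandNeighbors (d W : ℕ) : Set (Fin d → ℤ) :=
  {k | 1 ≤ latticeNorm k ∧ latticeNorm k ≤ W}

/-- The common degree of the vertices of the graph on `ℤ^d` in which `x ∼ y` iff
`1 ≤ ‖x - y‖₂ ≤ W`. -/
noncomputable def bandDegree (d W : ℕ) : ℕ := (bandNeighbors d W).ncard

open Classical in
/-- The band matrix on the box `{1, …, N}^d`: the diagonal is the vertex degree, the entry at `(i, j)`
is `-a i j` if `1 ≤ ‖i - j‖₂ ≤ W`, and all other entries vanish. -/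
noncomputable def bandMatrix (d N W : ℕ) (a : latticeBox d N → latticeBox d N → ℝ) :
    Matrix (latticeBox d N) (latticeBox d N) ℝ :=
  Matrix.of fun i j =>
    if i = j then (bandDegree d W : ℝ)
    else if 1 ≤ latticeNorm (i.1 - j.1) ∧ latticeNorm (i.1 - j.1) ≤ W then -a i j
    else 0

/-- The ground state energy of a real matrix: its smallest (real) eigenvalue. -/
noncomputable def groundStateEnergy {n : Type*} [Fintype n] [DecidableEq n]
    (H : Matrix n n ℝ) : ℝ :=
  sInf {μ : ℝ | Module.End.HasEigenvalue (Matrix.toLin' H) μ}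

/-- The landscape function `u = H⁻¹ 𝟙` of a matrix. -/
noncomputable def landscape {n : Type*} [Fintype n] [DecidableEq n]
    (H : Matrix n n ℝ) : n → ℝ :=
  H⁻¹.mulVec (fun _ => 1)

theorem latticeNorm_sq {d : ℕ} (k : Fin d → ℤ) :
    latticeNorm k ^ 2 = ((∑ i, k i ^ 2 : ℤ) : ℝ) := by
  unfold latticeNorm
  rw [EuclideanSpace.norm_sq_eq]
  simp

theorem mem_bandNeighbors {d W : ℕ} (k : Fin d → ℤ) :
    k ∈ bandNeighbors d W ↔ 1 ≤ ∑ i, k i ^ 2 ∧ ∑ i, k i ^ 2 ≤ (W : ℤ) ^ 2 := by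
  have h0 : 0 ≤ latticeNorm k := norm_nonneg _
  have h1 : 1 ≤ latticeNorm k ↔ 1 ≤ ∑ i, k i ^ 2 := by
    rw [← one_le_sq_iff₀ h0, latticeNorm_sq]; norm_cast
  have h2 : latticeNorm k ≤ W ↔ ∑ i, k i ^ 2 ≤ (W : ℤ) ^ 2 := by
    rw [← sq_le_sq₀ h0 (Nat.cast_nonneg W), latticeNorm_sq]; norm_cast
  show 1 ≤ latticeNorm k ∧ latticeNorm k ≤ W ↔ _
  rw [h1, h2]

/-- The set counted by `bandDegree` is finite. -/
theorem bandNeighbors_finite (d W : ℕ) : (bandNeighbors d W).Finite := by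
  refine (Set.finite_Icc (fun _ : Fin d => -(W : ℤ)) (fun _ => (W : ℤ))).subset ?_
  intro k hk
  have h2 := ((mem_bandNeighbors k).1 hk).2
  have h : ∀ i, |k i| ≤ (W : ℤ) := fun i => by
    refine abs_le_of_sq_le_sq ?_ (by positivity)
    exact (Finset.single_le_sum (f := fun i => k i ^ 2) (fun j _ => sq_nonneg _)
      (Finset.mem_univ i)).trans h2
  exact ⟨fun i => (abs_le.1 (h i)).1, fun i => (abs_le.1 (h i)).2⟩

/-- In dimension one, and for the nearest neighbour model, the degree is `2dW`. -/
theorem bandDegree_eq (d W : ℕ) (h : d = 1 ∨ W = 1) : bandDegree d W = 2 * d * W := by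
  set S : Finset (Fin d × ℤ) := Finset.univ ×ˢ ((Finset.Icc (-(W : ℤ)) W).erase 0) with hS
  have hcard : S.card = 2 * d * W := by
    rw [hS, Finset.card_product, Finset.card_erase_of_mem (by simp)]
    simp only [Finset.card_univ, Fintype.card_fin, Int.card_Icc]
    have : ((W : ℤ) + 1 - -(W : ℤ)).toNat - 1 = 2 * W := by omega
    rw [this]; ring
  have hinj : Set.InjOn (fun p : Fin d × ℤ => (Pi.single p.1 p.2 : Fin d → ℤ)) S := by
    rintro ⟨i, m⟩ hi ⟨j, n⟩ hj hij
    have hm : m ≠ 0 := by simp [hS] at hi; exact hi.2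
    have e := congrFun hij i
    by_cases hne : i = j
    · subst hne; simp at e; simp [e]
    · simp [hne] at e; exact absurd e hm
  have himg : bandNeighbors d W
      = (fun p : Fin d × ℤ => (Pi.single p.1 p.2 : Fin d → ℤ)) '' S := by
    ext k
    rw [mem_bandNeighbors]
    constructor
    · rintro ⟨h1, h2⟩
      obtain ⟨i, hi⟩ : ∃ i, k i ≠ 0 := by
        by_contra! hk
        simp [hk] at h1
      have hk : k = Pi.single i (k i) := by
        funext j
        by_cases hj : j = i
        · subst hj; simp
        · rw [Pi.single_eq_of_ne hj]
          rcases h with rfl | rfl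
          · exact absurd (Subsingleton.elim j i) hj
          · have h3 := Finset.add_le_sum (f := fun i => k i ^ 2) (s := Finset.univ)
              (fun j _ => sq_nonneg (k j)) (Finset.mem_univ i) (Finset.mem_univ j) (Ne.symm hj)
            have h4 : 0 < k i ^ 2 := by positivity
            simp only [Nat.cast_one] at h2
            have h5 : k j ^ 2 ≤ 0 := by linarith
            nlinarith [pow_eq_zero_iff (two_ne_zero) |>.1 (le_antisymm h5 (sq_nonneg (k j)))]
      have h3 := Finset.single_le_sum (f := fun i => k i ^ 2) (fun j _ => sq_nonneg (k j))
        (Finset.mem_univ i)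
      have h4 := abs_le.1 (abs_le_of_sq_le_sq (h3.trans h2) (by positivity))
      refine ⟨(i, k i), ?_, hk.symm⟩
      simp [hS, hi, h4.1, h4.2]
    · rintro ⟨⟨i, m⟩, hi, rfl⟩
      simp [hS] at hi
      have : ∑ j, (Pi.single i m : Fin d → ℤ) j ^ 2 = m ^ 2 := by
        rw [Finset.sum_eq_single i] <;> simp +contextual
      simp only [this]
      refine ⟨?_, ?_⟩
      · have : 0 < m ^ 2 := by have := hi.2; positivity
        linarith
      · exact sq_le_sq' hi.1.1 hi.1.2
  rw [bandDegree, himg, Set.InjOn.ncard_image hinj, Set.ncard_coe_finset, hcard]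

/-! The lower bound follows from the minimum principle: for an eigenvector `v` with eigenvalue `μ`,
both `|μ| ‖v‖ u ± v` have nonnegative image under `H`, so `|v| ≤ |μ| ‖v‖ u`.

For the upper bound, let `M` be the maximum of `u`, attained at `x`, let `D` be the degree, and test
the quadratic form on `u √p`, where `p` counts the `T`-step lazy paths from `x`, with `T` about `(D
+ 1) M / 2`. As `H u = 1` and `a ≤ 1`, one lazy step lowers the mean of `u` by at most `1 / (D +
1)`, so `u` still has mean at least `M / 2` under the walk, and mean square at least `M² / 4`
(`le_add_sum_paths`). By the ground state substitution (`dotProduct_mulVec_mul_eq`) the form is `∑ u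
p` plus a gradient term in `√p`. That term is of order `M² / T`, hence of order `M`, relative to the
path total, by `sum_sq_sqrt_pathCount_sub_le`. Comparing, `λ M²` is at most a constant times `M`.

The decay in `T` needs no heat kernel estimate: exchanging one step for another expresses
differences of path counts through centred step counts, whose variance is linear in `T`. -/

/-! ### Path counts and their Hellinger smoothness -/

/-- Additivity of variance for independent centred steps, cleared of denominators. -/
theorem card_mul_sum_sq_sum_comp {β : Type*} [Fintype β] (f : β → ℝ) (hf : ∑ b, f b = 0)
    (T : ℕ) :
    (Fintype.card β : ℝ) * ∑ ω : Fin T → β, (∑ t, f (ω t)) ^ 2 =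
      T * (Fintype.card β : ℝ) ^ T * ∑ b, f b ^ 2 := by
  induction T with
  | zero => simp
  | succ T ih =>
    have key : ∑ ω : Fin (T + 1) → β, (∑ t, f (ω t)) ^ 2 =
        (Fintype.card β : ℝ) ^ T * ∑ b, f b ^ 2 +
          Fintype.card β * ∑ ω : Fin T → β, (∑ t, f (ω t)) ^ 2 := by
      rw [← (Fin.consEquiv (fun _ => β)).sum_comp, Fintype.sum_prod_type]
      simp only [Fin.consEquiv_apply, Fin.sum_univ_succ, Fin.cons_zero, Fin.cons_succ, add_sq,
        Finset.sum_add_distrib, ← Finset.mul_sum, ← Finset.sum_mul, hf]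
      simp [Finset.mul_sum]
    rw [key, mul_add, ih]
    push_cast
    ring

theorem sum_fiber_le {Ω G : Type*} [DecidableEq G] [Fintype Ω] (Y : Finset G) (S : Ω → G) (g : Ω → ℝ)
    (hg : ∀ ω, 0 ≤ g ω) :
    ∑ y ∈ Y, ∑ ω, (if S ω = y then g ω else 0) ≤ ∑ ω, g ω := by
  rw [Finset.sum_comm]
  refine Finset.sum_le_sum fun ω _ => ?_
  rw [Finset.sum_ite_eq]
  split_ifs
  exacts [le_rfl, hg ω]

/-- The number of `T`-step paths with steps `s b`, `b ∈ β`, that lead from the origin to `y`. -/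
noncomputable def pathCount {β G : Type*} [Fintype β] [AddCommGroup G] [DecidableEq G]
    (s : β → G) (T : ℕ) (y : G) : ℝ :=
  ∑ ω : Fin T → β, if ∑ t, s (ω t) = y then 1 else 0

section Walk

variable {β G : Type*} [Fintype β] [AddCommGroup G] [DecidableEq G] (s : β → G)

theorem pathCount_nonneg (T : ℕ) (y : G) : 0 ≤ pathCount s T y :=
  Finset.sum_nonneg fun _ _ => by split_ifs <;> norm_num

theorem sum_pathCount_le (T : ℕ) (Y : Finset G) :
    ∑ y ∈ Y, pathCount s T y ≤ (Fintype.card β : ℝ) ^ T := by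
  refine (sum_fiber_le Y _ (fun _ => 1) fun _ => zero_le_one).trans ?_
  simp

variable [DecidableEq β]

/-- Exchanging one step `b` for a step `b'` preserves the number of marked paths. -/
theorem sum_count_mul_indicator_eq (T : ℕ) (b b' : β) (y : G) :
    ∑ ω : Fin T → β, (if ∑ t, s (ω t) = y + s b then ∑ t, (if ω t = b then (1 : ℝ) else 0) else 0) =
    ∑ ω : Fin T → β,
      (if ∑ t, s (ω t) = y + s b' then ∑ t, (if ω t = b' then (1 : ℝ) else 0) else 0) := by
  have h : ∀ c : β, ∑ ω : Fin T → β,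
      (if ∑ t, s (ω t) = y + s c then ∑ t, (if ω t = c then (1 : ℝ) else 0) else 0) =
      ∑ t, ∑ ω : Fin T → β,
        if ω t = c ∧ ∑ r ∈ Finset.univ.erase t, s (ω r) = y then (1 : ℝ) else 0 := by
    intro c
    rw [Finset.sum_comm]
    refine Finset.sum_congr rfl fun ω _ => ?_
    have e : (if ∑ t, s (ω t) = y + s c then ∑ t, (if ω t = c then (1 : ℝ) else 0) else 0) =
        ∑ t, if ∑ t, s (ω t) = y + s c then (if ω t = c then (1 : ℝ) else 0) else 0 := by
      split_ifs <;> simp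
    rw [e]
    refine Finset.sum_congr rfl fun t _ => ?_
    by_cases ht : ω t = c
    · have : ∑ t, s (ω t) = y + s c ↔ ∑ r ∈ Finset.univ.erase t, s (ω r) = y := by
        rw [← Finset.sum_erase_add _ _ (Finset.mem_univ t), ht, add_left_inj]
      simp only [this, ht, if_true, true_and]
    · simp [ht]
  rw [h b, h b']
  refine Finset.sum_congr rfl fun t _ => ?_
  -- Swapping `b` and `b'` at the marked time `t` alone leaves the sum of the other steps unchanged.
  rw [← (Equiv.piCongrRight fun r => if r = t then Equiv.swap b b' else Equiv.refl β).sum_comp]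
  refine Finset.sum_congr rfl fun ω _ => ?_
  have e : ∑ r ∈ Finset.univ.erase t,
      s ((if r = t then Equiv.swap b b' else Equiv.refl β) (ω r)) =
      ∑ r ∈ Finset.univ.erase t, s (ω r) :=
    Finset.sum_congr rfl fun r hr => by rw [if_neg (Finset.ne_of_mem_erase hr)]; rfl
  have e' : Equiv.swap b b' (ω t) = b ↔ ω t = b' := by
    rw [Equiv.swap_apply_eq_iff, Equiv.swap_apply_left]
  simp only [Equiv.piCongrRight_apply, Pi.map_apply, e, if_true, e']

/-- Since `p + q ≤ (√p + √q)²`, passing to square roots gains the factor `p + q`, which cancels the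
one coming from the Cauchy–Schwarz bounds on `A` and `B`. -/
theorem sq_sqrt_sub_sqrt_mul_le {p q τ A B V X : ℝ} (hp : 0 ≤ p) (hq : 0 ≤ q) (hV : 0 ≤ V)
    (hX : 0 ≤ X) (h : (p - q) * τ = A - B) (hA : A ^ 2 ≤ X * q) (hB : B ^ 2 ≤ V * p) :
    (√p - √q) ^ 2 * τ ^ 2 ≤ 2 * (V + X) := by
  rcases (add_nonneg hp hq).eq_or_lt with h0 | h0
  · have h1 : p = 0 := by linarith
    have h2 : q = 0 := by linarith
    simp only [h1, h2, sub_self]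
    nlinarith
  · have h3 : (√p - √q) ^ 2 * (p + q) ≤ (p - q) ^ 2 := by
      have h4 : (p - q) ^ 2 = (√p - √q) ^ 2 * (√p + √q) ^ 2 := by
        conv_lhs => rw [← Real.sq_sqrt hp, ← Real.sq_sqrt hq]
        ring
      have h5 : p + q ≤ (√p + √q) ^ 2 := by
        nlinarith [Real.sq_sqrt hp, Real.sq_sqrt hq,
          mul_nonneg (Real.sqrt_nonneg p) (Real.sqrt_nonneg q)]
      rw [h4]
      exact mul_le_mul_of_nonneg_left h5 (sq_nonneg _)
    refine le_of_mul_le_mul_right ?_ h0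
    calc (√p - √q) ^ 2 * τ ^ 2 * (p + q) = (√p - √q) ^ 2 * (p + q) * τ ^ 2 := by ring
      _ ≤ (p - q) ^ 2 * τ ^ 2 := mul_le_mul_of_nonneg_right h3 (sq_nonneg _)
      _ = (A - B) ^ 2 := by rw [← h]; ring
      _ ≤ 2 * (X * q + V * p) := by nlinarith [sq_nonneg (A + B)]
      _ ≤ 2 * (V + X) * (p + q) := by nlinarith [mul_nonneg hV hq, mul_nonneg hX hp]

/-- The squared Hellinger distance between translates of the law of a random walk by two of its
steps decays like the inverse of the time. -/
theorem sum_sq_sqrt_pathCount_sub_le (T : ℕ) (b b' : β) (Y : Finset G) :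
    T * ∑ y ∈ Y, (√(pathCount s T (y + s b)) - √(pathCount s T (y + s b'))) ^ 2 ≤
      4 * Fintype.card β * (Fintype.card β : ℝ) ^ T := by
  set n : ℝ := (Fintype.card β : ℝ) with hn
  have hn0 : 0 < n := Nat.cast_pos.2 (Fintype.card_pos_iff.2 ⟨b⟩)
  rcases T.eq_zero_or_pos with rfl | hT
  · simpa using hn0.le
  have hT0 : (0 : ℝ) < T := Nat.cast_pos.2 hT
  -- Along a path, `∑ t, f c (ω t)` is the number of steps `c` minus its mean `T / n`; `A` and `V`
  -- are its first and second moments over paths ending at `y`.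
  let f : β → β → ℝ := fun c x => (if x = c then 1 else 0) - 1 / n
  let A : β → G → ℝ := fun c y =>
    ∑ ω : Fin T → β, if ∑ t, s (ω t) = y then ∑ t, f c (ω t) else 0
  let V : β → G → ℝ := fun c y =>
    ∑ ω : Fin T → β, if ∑ t, s (ω t) = y then (∑ t, f c (ω t)) ^ 2 else 0
  have hV0 : ∀ c y, 0 ≤ V c y := fun c y =>
    Finset.sum_nonneg fun _ _ => by split_ifs <;> positivity
  have hAV : ∀ c y, A c y ^ 2 ≤ V c y * pathCount s T y := fun c y => by
    refine Finset.sum_sq_le_sum_mul_sum_of_sq_le_mul _ (fun _ _ => ?_) (fun _ _ => ?_)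
      (fun _ _ => ?_)
    · split_ifs <;> positivity
    · split_ifs <;> norm_num
    · split_ifs <;> simp
  have hA : ∀ c y, A c y = (∑ ω : Fin T → β,
      if ∑ t, s (ω t) = y then ∑ t, (if ω t = c then (1 : ℝ) else 0) else 0) -
        pathCount s T y * (T / n) := fun c y => by
    simp only [A, f, pathCount, Finset.sum_mul, ← Finset.sum_sub_distrib]
    refine Finset.sum_congr rfl fun ω _ => ?_
    split_ifs
    · simp [div_eq_mul_inv]
    · simp
  have hVY : ∀ c, ∑ y ∈ Y, V c (y + s c) ≤ T * n ^ T / n := fun c => by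
    have h1 : ∑ y ∈ Y, V c (y + s c) ≤ ∑ ω : Fin T → β, (∑ t, f c (ω t)) ^ 2 := by
      refine (Finset.sum_map Y (addRightEmbedding (s c)) (V c)).ge.trans ?_
      exact sum_fiber_le _ _ _ fun _ => sq_nonneg _
    have h2 : ∑ x, f c x = 0 := by
      simp [f, ← hn, hn0.ne']
    have h3 : ∑ x, f c x ^ 2 ≤ 1 := by
      have : ∑ x, f c x ^ 2 = 1 - 1 / n := by
        have : ∀ x, f c x ^ 2 = (if x = c then 1 - 1 / n else 0) - 1 / n * f c x := fun x => by
          simp only [f]; split_ifs <;> ring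
        simp only [this, Finset.sum_sub_distrib, ← Finset.mul_sum, h2]
        simp
      rw [this]
      have : 0 < 1 / n := by positivity
      linarith
    have h4 := card_mul_sum_sq_sum_comp (f c) h2 T
    rw [← hn] at h4
    rw [le_div_iff₀' hn0]
    calc n * ∑ y ∈ Y, V c (y + s c) ≤ n * ∑ ω : Fin T → β, (∑ t, f c (ω t)) ^ 2 :=
          mul_le_mul_of_nonneg_left h1 hn0.le
      _ ≤ T * n ^ T := by
          rw [h4]; exact mul_le_of_le_one_right (by positivity) h3
  have hpt : ∀ y, (√(pathCount s T (y + s b)) - √(pathCount s T (y + s b'))) ^ 2 * (T / n) ^ 2 ≤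
      2 * (V b (y + s b) + V b' (y + s b')) := fun y => by
    refine sq_sqrt_sub_sqrt_mul_le (pathCount_nonneg s T _) (pathCount_nonneg s T _) (hV0 _ _)
      (hV0 _ _) ?_ (hAV b' _) (hAV b _)
    rw [hA, hA, sum_count_mul_indicator_eq s T b b' y]
    ring
  have hsum := Finset.sum_le_sum fun y (_ : y ∈ Y) => hpt y
  rw [← Finset.sum_mul, ← Finset.mul_sum, Finset.sum_add_distrib] at hsum
  have h5 := hsum.trans (mul_le_mul_of_nonneg_left (add_le_add (hVY b) (hVY b')) zero_le_two)
  set E := ∑ y ∈ Y, (√(pathCount s T (y + s b)) - √(pathCount s T (y + s b'))) ^ 2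
  refine le_of_mul_le_mul_left ?_ (show 0 < T / n ^ 2 by positivity)
  calc T / n ^ 2 * (T * E) = E * (T / n) ^ 2 := by ring
    _ ≤ 2 * (T * n ^ T / n + T * n ^ T / n) := h5
    _ = T / n ^ 2 * (4 * n * n ^ T) := by field_simp; ring

omit [DecidableEq β] [DecidableEq G] in
theorem le_add_sum_paths [Nonempty β] (U : G → ℝ) (c : ℝ)
    (hU : ∀ x, U x ≤ c + (∑ b, U (x + s b)) / Fintype.card β) (T : ℕ) (x : G) :
    U x ≤ T * c + (∑ ω : Fin T → β, U (x + ∑ t, s (ω t))) / (Fintype.card β : ℝ) ^ T := by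
  induction T generalizing x with
  | zero => simp
  | succ T ih =>
    set n : ℝ := (Fintype.card β : ℝ) with hn
    have hn0 : 0 < n := Nat.cast_pos.2 Fintype.card_pos
    have key : ∑ ω : Fin (T + 1) → β, U (x + ∑ t, s (ω t)) =
        ∑ b, ∑ ω : Fin T → β, U (x + s b + ∑ t, s (ω t)) := by
      rw [← (Fin.consEquiv (fun _ => β)).sum_comp, Fintype.sum_prod_type]
      simp [Fin.consEquiv_apply, Fin.sum_univ_succ, add_assoc]
    refine (hU x).trans ((add_le_add_right (div_le_div_of_nonneg_right
      (Finset.sum_le_sum fun b _ => ih (x + s b)) hn0.le) c).trans_eq ?_)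
    rw [key, Finset.sum_add_distrib, ← Finset.sum_div, Finset.sum_const, Finset.card_univ,
      nsmul_eq_mul, ← hn]
    push_cast
    field_simp
    ring

end Walk

/-! ### Ground state energy, quadratic form and landscape of a general matrix -/

section Matrix

open scoped Matrix

variable {n : Type*} [Fintype n] [DecidableEq n] {H : Matrix n n ℝ}

theorem groundStateEnergy_isLeast [Nonempty n] (hH : H.IsHermitian) :
    IsLeast {μ : ℝ | Module.End.HasEigenvalue (Matrix.toLin' H) μ} (groundStateEnergy H) := by
  have hfin : {μ : ℝ | Module.End.HasEigenvalue (Matrix.toLin' H) μ}.Finite :=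
    Module.End.finite_hasEigenvalue _
  obtain ⟨i⟩ := ‹Nonempty n›
  have hne : {μ : ℝ | Module.End.HasEigenvalue (Matrix.toLin' H) μ}.Nonempty := by
    refine ⟨hH.eigenvalues i, Module.End.hasEigenvalue_of_hasEigenvector
      (x := (hH.eigenvectorBasis i).ofLp) ⟨?_, ?_⟩⟩
    · rw [Module.End.mem_eigenspace_iff, Matrix.toLin'_apply]
      exact hH.mulVec_eigenvectorBasis i
    · exact (WithLp.ofLp_eq_zero 2).ne.2 (hH.eigenvectorBasis.orthonormal.ne_zero i)
  exact ⟨hne.csInf_mem hfin, fun μ hμ => csInf_le hfin.bddBelow hμ⟩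

/-- Rayleigh's principle: an eigenvalue of `H - l • 1`, shifted by `l`, is an eigenvalue of `H`, so
`H - l • 1` is positive semidefinite. -/
theorem groundStateEnergy_mul_le [Nonempty n] (hH : H.IsHermitian) (v : n → ℝ) :
    groundStateEnergy H * (v ⬝ᵥ v) ≤ v ⬝ᵥ (H *ᵥ v) := by
  set l := groundStateEnergy H with hl
  have hA : (H - l • (1 : Matrix n n ℝ)).IsHermitian :=
    hH.sub (by simp [Matrix.IsHermitian])
  have hps : (H - l • (1 : Matrix n n ℝ)).PosSemidef := by
    rw [hA.posSemidef_iff_eigenvalues_nonneg]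
    intro i
    have h1 := hA.mulVec_eigenvectorBasis i
    rw [Matrix.sub_mulVec, Matrix.smul_mulVec, Matrix.one_mulVec, sub_eq_iff_eq_add,
      ← add_smul] at h1
    have h2 := (groundStateEnergy_isLeast hH).2 (Module.End.hasEigenvalue_of_hasEigenvector
      (f := Matrix.toLin' H) (x := (hA.eigenvectorBasis i).ofLp) ⟨by
        rw [Module.End.mem_eigenspace_iff, Matrix.toLin'_apply]; exact h1,
        (WithLp.ofLp_eq_zero 2).ne.2 (hA.eigenvectorBasis.orthonormal.ne_zero i)⟩)
    simp only [Pi.zero_apply]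
    linarith
  have h := hps.dotProduct_mulVec_nonneg v
  rw [Matrix.sub_mulVec, Matrix.smul_mulVec, Matrix.one_mulVec, dotProduct_sub,
    dotProduct_smul, star_trivial, smul_eq_mul] at h
  linarith

omit [DecidableEq n] in
/-- The ground state substitution: the quadratic form of a symmetric matrix at `u χ`. -/
theorem dotProduct_mulVec_mul_eq (hH : ∀ i j, H i j = H j i) (u χ : n → ℝ) :
    (fun i => u i * χ i) ⬝ᵥ (H *ᵥ fun i => u i * χ i) =
      ∑ i, χ i ^ 2 * (u i * (H *ᵥ u) i) +
        (∑ i, ∑ j, -H i j * (u i * u j * (χ i - χ j) ^ 2)) / 2 := by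
  have h1 : ∑ i, χ i ^ 2 * (u i * (H *ᵥ u) i) = ∑ i, ∑ j, H i j * (u i * u j * χ i ^ 2) := by
    refine Finset.sum_congr rfl fun i _ => ?_
    simp only [Matrix.mulVec, dotProduct, Finset.mul_sum]
    exact Finset.sum_congr rfl fun j _ => by ring
  have h2 : ∑ i, ∑ j, H i j * (u i * u j * χ i ^ 2) = ∑ i, ∑ j, H i j * (u i * u j * χ j ^ 2) := by
    rw [Finset.sum_comm]
    exact Finset.sum_congr rfl fun i _ => Finset.sum_congr rfl fun j _ => by rw [hH]; ring
  have h3 : (fun i => u i * χ i) ⬝ᵥ (H *ᵥ fun i => u i * χ i) =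
      ∑ i, ∑ j, H i j * (u i * u j * (χ i * χ j)) := by
    simp only [Matrix.mulVec, dotProduct, Finset.mul_sum]
    exact Finset.sum_congr rfl fun i _ => Finset.sum_congr rfl fun j _ => by ring
  have h4 : ∑ i, ∑ j, -H i j * (u i * u j * (χ i - χ j) ^ 2) =
      2 * ∑ i, ∑ j, H i j * (u i * u j * (χ i * χ j)) -
        (∑ i, ∑ j, H i j * (u i * u j * χ i ^ 2) + ∑ i, ∑ j, H i j * (u i * u j * χ j ^ 2)) := by
    simp only [Finset.mul_sum, ← Finset.sum_add_distrib, ← Finset.sum_sub_distrib]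
    exact Finset.sum_congr rfl fun i _ => Finset.sum_congr rfl fun j _ => by ring
  rw [h1, h3, h4, ← h2]
  ring

/-- The minimum principle applies to both `v` and `-v` when `v` is in the kernel. -/
theorem det_ne_zero_of_mulVec_nonneg (h : ∀ v, 0 ≤ H *ᵥ v → 0 ≤ v) : H.det ≠ 0 := by
  intro h0
  obtain ⟨v, hv, hv0⟩ := Matrix.exists_mulVec_eq_zero_iff.2 h0
  refine hv (le_antisymm ?_ (h v hv0.ge))
  exact neg_nonneg.1 (h (-v) (by rw [Matrix.mulVec_neg, hv0, neg_zero]))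

theorem mulVec_landscape (h : H.det ≠ 0) : H *ᵥ landscape H = fun _ => 1 := by
  rw [landscape, Matrix.mulVec_mulVec, Matrix.mul_nonsing_inv _ h.isUnit, Matrix.one_mulVec]

/-- The landscape bound for an eigenvector of a matrix with a minimum principle. -/
theorem one_le_abs_mul_norm_landscape (h : ∀ v, 0 ≤ H *ᵥ v → 0 ≤ v) {μ : ℝ}
    (hμ : Module.End.HasEigenvalue (Matrix.toLin' H) μ) : 1 ≤ |μ| * ‖landscape H‖ := by
  obtain ⟨v, hv⟩ := hμ.exists_hasEigenvector
  have hv0 : 0 < ‖v‖ := norm_pos_iff.2 hv.2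
  have hvH : H *ᵥ v = μ • v := by
    have := hv.apply_eq_smul
    rwa [Matrix.toLin'_apply] at this
  have hu := mulVec_landscape (det_ne_zero_of_mulVec_nonneg h)
  have hle : ∀ i, |μ * v i| ≤ |μ| * ‖v‖ := fun i => by
    rw [abs_mul]
    exact mul_le_mul_of_nonneg_left (norm_le_pi_norm v i) (abs_nonneg _)
  have h1 : 0 ≤ (|μ| * ‖v‖) • landscape H - v := h _ fun i => by
    rw [Matrix.mulVec_sub, Matrix.mulVec_smul, hu, hvH]
    have := (abs_le.1 (hle i)).2
    simpa using this
  have h2 : 0 ≤ (|μ| * ‖v‖) • landscape H + v := h _ fun i => by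
    rw [Matrix.mulVec_add, Matrix.mulVec_smul, hu, hvH]
    have := (abs_le.1 (hle i)).1
    simp only [Pi.zero_apply, Pi.add_apply, Pi.smul_apply, smul_eq_mul, mul_one]
    linarith
  have h3 : ‖v‖ ≤ |μ| * ‖v‖ * ‖landscape H‖ := by
    refine (pi_norm_le_iff_of_nonneg (by positivity)).2 fun i => ?_
    have a1 := h1 i
    have a2 := h2 i
    simp only [Pi.zero_apply, Pi.add_apply, Pi.sub_apply, Pi.smul_apply, smul_eq_mul] at a1 a2
    have a3 : |μ| * ‖v‖ * landscape H i ≤ |μ| * ‖v‖ * ‖landscape H‖ :=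
      mul_le_mul_of_nonneg_left ((le_abs_self _).trans (norm_le_pi_norm (landscape H) i))
        (by positivity)
    rw [Real.norm_eq_abs, abs_le]
    constructor <;> linarith
  refine le_of_mul_le_mul_right ?_ hv0
  linarith

end Matrix

/-! ### The band matrix: minimum principle and lazy walk -/

/-- The lattice vectors of Euclidean length between `1` and `W`, as a finset. -/
noncomputable def bandSteps (d W : ℕ) : Finset (Fin d → ℤ) := (bandNeighbors_finite d W).toFinset

/-- The extension by zero of a function on the box to the lattice. -/
noncomputable def zeroExt {d N : ℕ} (f : latticeBox d N → ℝ) (x : Fin d → ℤ) : ℝ :=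
  ∑ j : latticeBox d N, if j.1 = x then f j else 0

section Band

variable {d N W : ℕ} {a : latticeBox d N → latticeBox d N → ℝ}

theorem mem_bandSteps {k : Fin d → ℤ} :
    k ∈ bandSteps d W ↔ 1 ≤ latticeNorm k ∧ latticeNorm k ≤ W := by
  simp [bandSteps, bandNeighbors]

theorem card_bandSteps : (bandSteps d W).card = bandDegree d W :=
  (Set.ncard_eq_toFinset_card _ (bandNeighbors_finite d W)).symm

theorem latticeNorm_neg (k : Fin d → ℤ) : latticeNorm (-k) = latticeNorm k := by
  have h : ∀ x : Fin d → ℤ, 0 ≤ latticeNorm x := fun _ => norm_nonneg _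
  rw [← sq_eq_sq₀ (h _) (h _)]
  simp [latticeNorm_sq]

theorem sub_mem_bandSteps_comm (x y : Fin d → ℤ) :
    x - y ∈ bandSteps d W ↔ y - x ∈ bandSteps d W := by
  rw [mem_bandSteps, mem_bandSteps, ← neg_sub, latticeNorm_neg]

theorem zero_notMem_bandSteps : (0 : Fin d → ℤ) ∉ bandSteps d W := by
  intro h
  have := ((mem_bandNeighbors _).1 (mem_bandSteps.1 h)).1
  simp at this

theorem single_mem_bandSteps (hW : 1 ≤ W) (i : Fin d) : Pi.single i 1 ∈ bandSteps d W := by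
  refine mem_bandSteps.2 ((mem_bandNeighbors _).2 ?_)
  have : ∑ j, (Pi.single i 1 : Fin d → ℤ) j ^ 2 = 1 := by
    rw [Finset.sum_eq_single i] <;> simp +contextual
  rw [this]
  exact ⟨le_rfl, one_le_pow₀ (by exact_mod_cast hW)⟩

theorem zeroExt_apply (f : latticeBox d N → ℝ) (j : latticeBox d N) : zeroExt f j.1 = f j := by
  simp [zeroExt]

theorem zeroExt_of_notMem (f : latticeBox d N → ℝ) {x : Fin d → ℤ} (hx : x ∉ latticeBox d N) :
    zeroExt f x = 0 :=
  Finset.sum_eq_zero fun j _ => if_neg fun h : j.1 = x => hx (h ▸ j.2)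

theorem zeroExt_nonneg {f : latticeBox d N → ℝ} (hf : ∀ j, 0 ≤ f j) (x : Fin d → ℤ) :
    0 ≤ zeroExt f x :=
  Finset.sum_nonneg fun j _ => by split_ifs; exacts [hf j, le_rfl]

theorem sum_ite_sub_mem_bandSteps (f : latticeBox d N → ℝ) (x : Fin d → ℤ) :
    ∑ j : latticeBox d N, (if x - j.1 ∈ bandSteps d W then f j else 0) =
      ∑ k ∈ bandSteps d W, zeroExt f (x - k) := by
  simp only [zeroExt]
  rw [Finset.sum_comm]
  refine Finset.sum_congr rfl fun j _ => ?_
  have : ∀ k, j.1 = x - k ↔ x - j.1 = k := fun k => by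
    rw [eq_sub_iff_add_eq', sub_eq_iff_eq_add', eq_comm, add_comm]
  simp only [this]
  rw [Finset.sum_ite_eq]

theorem bandMatrix_apply (i j : latticeBox d N) :
    bandMatrix d N W a i j =
      (if i = j then (bandDegree d W : ℝ) else 0) -
        (if i.1 - j.1 ∈ bandSteps d W then a i j else 0) := by
  rw [bandMatrix, Matrix.of_apply]
  simp only [← mem_bandSteps]
  by_cases h : i = j
  · subst h
    simp [zero_notMem_bandSteps]
  · simp only [h, if_false]
    split_ifs <;> simp

theorem bandMatrix_comm (ha : ∀ i j, a i j = a j i) (i j : latticeBox d N) :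
    bandMatrix d N W a i j = bandMatrix d N W a j i := by
  rw [bandMatrix_apply, bandMatrix_apply, ha i j]
  simp only [sub_mem_bandSteps_comm i.1 j.1, eq_comm (a := i)]

theorem bandMatrix_mulVec (v : latticeBox d N → ℝ) (i : latticeBox d N) :
    (bandMatrix d N W a).mulVec v i = bandDegree d W * v i -
      ∑ j : latticeBox d N, if i.1 - j.1 ∈ bandSteps d W then a i j * v j else 0 := by
  simp [Matrix.mulVec, dotProduct, bandMatrix_apply, sub_mul, Finset.sum_sub_distrib, ite_mul]

/-- The minimum principle for the band matrix. -/
theorem nonneg_of_bandMatrix_mulVec_nonneg (hd : 1 ≤ d) (hW : 1 ≤ W)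
    (ha : ∀ i j, a i j ∈ Set.Icc (0 : ℝ) 1) (v : latticeBox d N → ℝ)
    (hv : 0 ≤ (bandMatrix d N W a).mulVec v) : 0 ≤ v := by
  intro l
  let c : Fin d := ⟨0, hd⟩
  have : Nonempty (latticeBox d N) := ⟨l⟩
  -- Breaking ties by the coordinate `c` makes the lattice neighbour `i - e_c` either lie outside
  -- the box or carry a strictly larger value. This gives strictness even if hoppings vanish.
  obtain ⟨i, hi⟩ := Finite.exists_min fun j : latticeBox d N => toLex (v j, j.1 c)
  have hi1 : ∀ j, v i ≤ v j := fun j => by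
    rcases (Prod.Lex.toLex_le_toLex.1 (hi j)) with h | h
    exacts [h.le, h.1.le]
  refine le_trans ?_ (hi1 l)
  by_contra! hneg
  rw [Pi.zero_apply] at hneg
  have h0 := hv i
  rw [bandMatrix_mulVec, Pi.zero_apply, sub_nonneg] at h0
  have h1 : ∑ k ∈ bandSteps d W, zeroExt (fun j => min (v j) 0) (i.1 - k) ≤
      ∑ j : latticeBox d N, if i.1 - j.1 ∈ bandSteps d W then a i j * v j else 0 := by
    rw [← sum_ite_sub_mem_bandSteps]
    refine Finset.sum_le_sum fun j _ => ?_
    split_ifs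
    · obtain ⟨h2, h3⟩ := ha i j
      rcases le_total 0 (v j) with h4 | h4
      · exact (min_le_right _ _).trans (mul_nonneg h2 h4)
      · rw [min_eq_left h4]; nlinarith
    · exact le_rfl
  have hlow : ∀ x, v i ≤ zeroExt (fun j => min (v j) 0) x := fun x => by
    by_cases hx : x ∈ latticeBox d N
    · rw [zeroExt_apply _ ⟨x, hx⟩]
      exact le_min (hi1 _) hneg.le
    · rw [zeroExt_of_notMem _ hx]
      exact hneg.le
  have h2 : ∑ _k ∈ bandSteps d W, v i <
      ∑ k ∈ bandSteps d W, zeroExt (fun j => min (v j) 0) (i.1 - k) := by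
    refine Finset.sum_lt_sum (fun k _ => hlow _) ⟨_, single_mem_bandSteps hW c, ?_⟩
    by_cases hx : i.1 - Pi.single c 1 ∈ latticeBox d N
    · rw [zeroExt_apply _ ⟨_, hx⟩]
      refine lt_min ?_ hneg
      rcases (Prod.Lex.toLex_le_toLex.1 (hi ⟨_, hx⟩)) with h | h
      · exact h
      · have := h.2
        simp at this
    · rw [zeroExt_of_notMem _ hx]
      exact hneg
  rw [Finset.sum_const, card_bandSteps, nsmul_eq_mul] at h2
  linarith

/-- The steps of the lazy walk on the band graph. -/
def lazyStep (b : Option (bandSteps d W)) : Fin d → ℤ := b.elim 0 fun k => -k.1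

theorem card_option_bandSteps :
    (Fintype.card (Option (bandSteps d W)) : ℝ) = bandDegree d W + 1 := by
  simp [card_bandSteps]

/-- Raising every hopping to `1` turns `H u = 1` into an inequality for the free walk on the whole
lattice; adding `u x` to both sides makes the walk lazy. Off the box the left side is zero. -/
theorem zeroExt_le_sum_lazyStep (ha : ∀ i j, a i j ∈ Set.Icc (0 : ℝ) 1) {u : latticeBox d N → ℝ}
    (hu0 : ∀ i, 0 ≤ u i) (hu : (bandMatrix d N W a).mulVec u = fun _ => 1) (x : Fin d → ℤ) :
    zeroExt u x ≤ 1 / ((bandDegree d W : ℝ) + 1) + (∑ b : Option (bandSteps d W),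
      zeroExt u (x + lazyStep b)) / Fintype.card (Option (bandSteps d W)) := by
  have hn : (0 : ℝ) < bandDegree d W + 1 := by positivity
  rw [card_option_bandSteps, ← add_div, le_div_iff₀ hn, Fintype.sum_option]
  have hsum : ∑ k : bandSteps d W, zeroExt u (x + lazyStep (some k)) =
      ∑ k ∈ bandSteps d W, zeroExt u (x - k) := by
    rw [← Finset.sum_coe_sort (bandSteps d W) fun k => zeroExt u (x - k)]
    simp [lazyStep, sub_eq_add_neg]
  have h0 : lazyStep (none : Option (bandSteps d W)) = 0 := rfl
  rw [hsum, h0, add_zero]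
  by_cases hx : x ∈ latticeBox d N
  · have h1 := congrFun hu ⟨x, hx⟩
    rw [bandMatrix_mulVec, sub_eq_iff_eq_add] at h1
    have h2 : ∑ j : latticeBox d N, (if x - j.1 ∈ bandSteps d W then a ⟨x, hx⟩ j * u j else 0) ≤
        ∑ k ∈ bandSteps d W, zeroExt u (x - k) := by
      rw [← sum_ite_sub_mem_bandSteps]
      refine Finset.sum_le_sum fun j _ => ?_
      split_ifs
      exacts [mul_le_of_le_one_left (hu0 j) (ha _ j).2, le_rfl]
    rw [← zeroExt_apply u ⟨x, hx⟩] at h1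
    dsimp only at h1
    linarith
  · rw [zeroExt_of_notMem _ hx]
    have := Finset.sum_nonneg fun k (_ : k ∈ bandSteps d W) => zeroExt_nonneg hu0 (x - k)
    linarith

theorem sum_paths_zeroExt (u : latticeBox d N → ℝ) (x : Fin d → ℤ) (T : ℕ) :
    ∑ ω : Fin T → Option (bandSteps d W), zeroExt u (x + ∑ t, lazyStep (ω t)) =
      ∑ i, u i * pathCount (lazyStep (d := d) (W := W)) T (i.1 - x) := by
  simp only [zeroExt, pathCount, Finset.mul_sum]
  rw [Finset.sum_comm]
  refine Finset.sum_congr rfl fun i _ => Finset.sum_congr rfl fun ω _ => ?_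
  rw [mul_ite, mul_one, mul_zero]
  exact if_congr (by rw [eq_sub_iff_add_eq', eq_comm]) rfl rfl

/-- The gradient term of the test function `u * √p`, where `p` counts paths of the lazy walk. -/
theorem sum_gradient_sqrt_pathCount_le (ha : ∀ i j, a i j ∈ Set.Icc (0 : ℝ) 1)
    {u : latticeBox d N → ℝ} {M : ℝ} (hu0 : ∀ i, 0 ≤ u i) (huM : ∀ i, u i ≤ M)
    (x : Fin d → ℤ) (T : ℕ) (χ : latticeBox d N → ℝ)
    (hχ : χ = fun i => √(pathCount (lazyStep (d := d) (W := W)) T (i.1 - x))) :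
    T * ∑ i, ∑ j, -bandMatrix d N W a i j * (u i * u j * (χ i - χ j) ^ 2) ≤
      M ^ 2 * (bandDegree d W * (4 * (bandDegree d W + 1) * (bandDegree d W + 1 : ℝ) ^ T)) := by
  set p := pathCount (lazyStep (d := d) (W := W)) T with hp
  have h1 : ∀ i, ∑ j, -bandMatrix d N W a i j * (u i * u j * (χ i - χ j) ^ 2) ≤
      ∑ k ∈ bandSteps d W, M ^ 2 * (√(p (i.1 - x + -k)) - √(p (i.1 - x + 0))) ^ 2 := fun i => by
    calc _ ≤ ∑ j : latticeBox d N,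
          (if i.1 - j.1 ∈ bandSteps d W then M ^ 2 * (χ i - χ j) ^ 2 else 0) := by
          refine Finset.sum_le_sum fun j _ => ?_
          rw [bandMatrix_apply]
          have h2 : u i * u j ≤ M ^ 2 := by
            rw [sq]
            exact mul_le_mul (huM i) (huM j) (hu0 j) ((hu0 i).trans (huM i))
          have h3 : u i * u j * (χ i - χ j) ^ 2 ≤ M ^ 2 * (χ i - χ j) ^ 2 :=
            mul_le_mul_of_nonneg_right h2 (sq_nonneg _)
          have h4 : 0 ≤ u i * u j * (χ i - χ j) ^ 2 :=
            mul_nonneg (mul_nonneg (hu0 i) (hu0 j)) (sq_nonneg _)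
          by_cases hij : i = j
          · subst hij; simp [zero_notMem_bandSteps]
          · simp only [hij, if_false, zero_sub, neg_neg]
            split_ifs
            · exact (mul_le_of_le_one_left h4 (ha i j).2).trans h3
            · simp
      _ ≤ _ := by
          rw [sum_ite_sub_mem_bandSteps fun j => M ^ 2 * (χ i - χ j) ^ 2]
          refine Finset.sum_le_sum fun k _ => ?_
          by_cases hx : i.1 - k ∈ latticeBox d N
          · rw [zeroExt_apply _ ⟨_, hx⟩, hχ]
            have e : i.1 - k - x = i.1 - x + -k := by abel
            dsimp only
            rw [e, add_zero, sub_sq_comm]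
          · rw [zeroExt_of_notMem _ hx]
            positivity
  have h2 : ∀ k ∈ bandSteps d W, T * ∑ i : latticeBox d N,
      (√(p (i.1 - x + -k)) - √(p (i.1 - x + 0))) ^ 2 ≤
        4 * (bandDegree d W + 1) * (bandDegree d W + 1 : ℝ) ^ T := fun k hk => by
    -- Laziness is used here: the zero step `none` lets neighbouring points be compared directly,
    -- with no parity obstruction.
    have := sum_sq_sqrt_pathCount_sub_le (lazyStep (d := d) (W := W)) T (some ⟨k, hk⟩) none
      (Finset.univ.map ⟨fun i : latticeBox d N => i.1 - x, fun i j h =>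
        Subtype.ext (sub_left_injective h)⟩)
    rw [Finset.sum_map, card_option_bandSteps] at this
    exact this
  calc _ ≤ T * ∑ i : latticeBox d N, ∑ k ∈ bandSteps d W,
        M ^ 2 * (√(p (i.1 - x + -k)) - √(p (i.1 - x + 0))) ^ 2 :=
        mul_le_mul_of_nonneg_left (Finset.sum_le_sum fun i _ => h1 i) (Nat.cast_nonneg T)
    _ = M ^ 2 * ∑ k ∈ bandSteps d W, (T * ∑ i : latticeBox d N,
        (√(p (i.1 - x + -k)) - √(p (i.1 - x + 0))) ^ 2) := by
        rw [Finset.sum_comm]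
        simp only [← Finset.mul_sum]
        ring
    _ ≤ M ^ 2 * ∑ _k ∈ bandSteps d W, 4 * (bandDegree d W + 1) * (bandDegree d W + 1 : ℝ) ^ T :=
        mul_le_mul_of_nonneg_left (Finset.sum_le_sum h2) (sq_nonneg M)
    _ = _ := by rw [Finset.sum_const, card_bandSteps, nsmul_eq_mul]

/-! ### The upper bound -/

theorem groundStateEnergy_bandMatrix_le (hH : (bandMatrix d N W a).IsHermitian)
    (i : latticeBox d N) : groundStateEnergy (bandMatrix d N W a) ≤ bandDegree d W := by
  have : Nonempty (latticeBox d N) := ⟨i⟩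
  have h := groundStateEnergy_mul_le hH (Pi.single i 1)
  simpa [bandMatrix_apply, zero_notMem_bandSteps] using h

theorem groundStateEnergy_mul_norm_le (ha : ∀ i j, a i j ∈ Set.Icc (0 : ℝ) 1)
    (ha' : ∀ i j, a i j = a j i) [Nonempty (latticeBox d N)] {u : latticeBox d N → ℝ}
    (hu0 : ∀ i, 0 < u i) (hu : (bandMatrix d N W a).mulVec u = fun _ => 1)
    (hl : 0 ≤ groundStateEnergy (bandMatrix d N W a)) :
    groundStateEnergy (bandMatrix d N W a) * ‖u‖ ≤ 4 + 32 * bandDegree d W := by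
  have hH : (bandMatrix d N W a).IsHermitian :=
    Matrix.IsHermitian.ext fun i j => bandMatrix_comm ha' j i
  obtain ⟨x, hx⟩ := Finite.exists_max u
  set M := u x with hM
  set l := groundStateEnergy (bandMatrix d N W a)
  set D : ℝ := (bandDegree d W : ℝ) with hD
  have hD0 : 0 ≤ D := Nat.cast_nonneg _
  have hM0 : 0 < M := hu0 x
  have hnorm : ‖u‖ ≤ M := (pi_norm_le_iff_of_nonneg hM0.le).2 fun i => by
    rw [Real.norm_of_nonneg (hu0 i).le]; exact hx i
  refine (mul_le_mul_of_nonneg_left hnorm hl).trans ?_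
  -- The longest time for which the accumulated loss `T / (D + 1)` stays below `M / 2`. If it is
  -- `0`, then `M` is bounded and the trivial bound `l ≤ D` suffices.
  obtain ⟨T, hT⟩ : ∃ T, T = ⌊(D + 1) * M / 2⌋₊ := ⟨_, rfl⟩
  have hT1 : (T : ℝ) ≤ (D + 1) * M / 2 := hT ▸ Nat.floor_le (by positivity)
  have hT2 : (D + 1) * M / 2 < T + 1 := hT ▸ Nat.lt_floor_add_one _
  rcases T.eq_zero_or_pos with rfl | hTpos
  · have := mul_le_mul_of_nonneg_right (groundStateEnergy_bandMatrix_le hH x) hM0.le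
    rw [Nat.cast_zero] at hT2
    nlinarith
  have hTpos' : (1 : ℝ) ≤ T := by exact_mod_cast hTpos
  have hT4 : (D + 1) * M ≤ 4 * T := by linarith
  set p := pathCount (lazyStep (d := d) (W := W)) T with hp
  have hp0 : ∀ y, 0 ≤ p y := pathCount_nonneg _ T
  set q : ℝ := (D + 1) ^ T with hq
  have hq0 : 0 < q := by positivity
  have hmean : q * (M / 2) ≤ ∑ i, u i * p (i.1 - x.1) := by
    have h := le_add_sum_paths (lazyStep (d := d) (W := W)) (zeroExt u) _
      (zeroExt_le_sum_lazyStep ha (fun i => (hu0 i).le) hu) T x.1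
    rw [sum_paths_zeroExt, zeroExt_apply, card_option_bandSteps, ← hM, ← hp, ← hD, ← hq] at h
    have h2 : T * (1 / (D + 1)) ≤ M / 2 := by
      rw [mul_one_div, div_le_iff₀ (by positivity)]
      linarith
    have h3 : M / 2 ≤ (∑ i, u i * p (i.1 - x.1)) / q := by linarith
    rwa [le_div_iff₀' hq0] at h3
  have hmass : ∑ i : latticeBox d N, p (i.1 - x.1) ≤ q := by
    have := sum_pathCount_le (lazyStep (d := d) (W := W)) T
      (Finset.univ.map ⟨fun i : latticeBox d N => i.1 - x.1, fun i j h =>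
        Subtype.ext (sub_left_injective h)⟩)
    rw [Finset.sum_map, card_option_bandSteps] at this
    exact this
  have hup : ∑ i, u i * p (i.1 - x.1) ≤ M * q := by
    refine le_trans (Finset.sum_le_sum fun i _ => mul_le_mul_of_nonneg_right (hx i) (hp0 _)) ?_
    rw [← Finset.mul_sum]
    exact mul_le_mul_of_nonneg_left hmass hM0.le
  -- Cauchy–Schwarz with weights `p`, of total mass at most `q`.
  have hsq : q * (M / 2) ^ 2 ≤ ∑ i, u i ^ 2 * p (i.1 - x.1) := by
    have h := Finset.sum_sq_le_sum_mul_sum_of_sq_le_mul Finset.univ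
      (r := fun i : latticeBox d N => u i * p (i.1 - x.1))
      (f := fun i => u i ^ 2 * p (i.1 - x.1)) (g := fun i => p (i.1 - x.1))
      (fun i _ => mul_nonneg (sq_nonneg _) (hp0 _)) (fun i _ => hp0 _) (fun i _ => by
        exact le_of_eq (by ring))
    have hS : 0 ≤ ∑ i, u i ^ 2 * p (i.1 - x.1) :=
      Finset.sum_nonneg fun i _ => mul_nonneg (sq_nonneg _) (hp0 _)
    refine le_of_mul_le_mul_right ?_ hq0
    calc q * (M / 2) ^ 2 * q = (q * (M / 2)) ^ 2 := by ring
      _ ≤ (∑ i, u i * p (i.1 - x.1)) ^ 2 := pow_le_pow_left₀ (by positivity) hmean 2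
      _ ≤ _ := h.trans (mul_le_mul_of_nonneg_left hmass hS)
  obtain ⟨χ, hχ⟩ : ∃ χ : latticeBox d N → ℝ, χ = fun i => √(p (i.1 - x.1)) := ⟨_, rfl⟩
  have hχ2 : ∀ i, χ i ^ 2 = p (i.1 - x.1) := fun i => by rw [hχ, Real.sq_sqrt (hp0 _)]
  have hvar := groundStateEnergy_mul_le hH fun i => u i * χ i
  rw [dotProduct_mulVec_mul_eq (bandMatrix_comm ha'), hu] at hvar
  have e1 : (fun i => u i * χ i) ⬝ᵥ (fun i => u i * χ i) = ∑ i, u i ^ 2 * p (i.1 - x.1) :=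
    Finset.sum_congr rfl fun i _ => by rw [← hχ2]; ring
  have e2 : ∑ i, χ i ^ 2 * (u i * 1) = ∑ i, u i * p (i.1 - x.1) :=
    Finset.sum_congr rfl fun i _ => by rw [hχ2]; ring
  rw [e1, e2] at hvar
  have hgrad := sum_gradient_sqrt_pathCount_le (W := W) ha (fun i => (hu0 i).le) hx x.1 T χ hχ
  set E := ∑ i, ∑ j, -bandMatrix d N W a i j * (u i * u j * (χ i - χ j) ^ 2)
  rw [← hD, ← hq] at hgrad
  have hE : E ≤ 16 * M * D * q := by
    refine le_of_mul_le_mul_left (hgrad.trans ?_) (show (0 : ℝ) < T by linarith)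
    have := mul_le_mul_of_nonneg_left hT4 (show 0 ≤ 4 * M * D * q by positivity)
    linarith
  have h1 : l * (q * (M / 2) ^ 2) ≤ M * q + 8 * M * D * q := by
    have := mul_le_mul_of_nonneg_left hsq hl
    linarith
  refine le_of_mul_le_mul_left ?_ (show 0 < q * M / 4 by positivity)
  linarith

end Band

/-! ### The landscape theorem -/

theorem mainTheorem5 (d W : ℕ) (hd : 1 ≤ d) (hW : 1 ≤ W) :
    ∃ C : ℝ, ∀ (N : ℕ), 1 ≤ N →
      ∀ (a : latticeBox d N → latticeBox d N → ℝ),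
        (∀ i j, a i j ∈ Set.Icc (0 : ℝ) 1) → (∀ i j, a i j = a j i) →
        IsLeast {μ : ℝ | Module.End.HasEigenvalue (Matrix.toLin' (bandMatrix d N W a)) μ}
          (groundStateEnergy (bandMatrix d N W a)) ∧
        (bandMatrix d N W a).det ≠ 0 ∧
        (∀ i, 0 < landscape (bandMatrix d N W a) i) ∧
        1 ≤ groundStateEnergy (bandMatrix d N W a) * ‖landscape (bandMatrix d N W a)‖ ∧
        groundStateEnergy (bandMatrix d N W a) * ‖landscape (bandMatrix d N W a)‖ ≤ C := by
  refine ⟨4 + 32 * bandDegree d W, fun N hN a ha ha' => ?_⟩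
  have : Nonempty (latticeBox d N) :=
    ⟨⟨fun _ => 1, Finset.mem_Icc.2 ⟨le_rfl, fun _ => Int.ofNat_le.2 hN⟩⟩⟩
  have hH : (bandMatrix d N W a).IsHermitian :=
    Matrix.IsHermitian.ext fun i j => bandMatrix_comm ha' j i
  have hmin := nonneg_of_bandMatrix_mulVec_nonneg (N := N) hd hW ha
  have hdet := det_ne_zero_of_mulVec_nonneg hmin
  have hleast := groundStateEnergy_isLeast hH
  set H := bandMatrix d N W a with hHdef
  have hu := mulVec_landscape hdet
  have hu0 : 0 ≤ landscape H := hmin _ (by rw [hu]; exact fun _ => zero_le_one)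
  have hpos : ∀ i, 0 < landscape H i := fun i => by
    have h1 := congrFun hu i
    rw [hHdef, bandMatrix_mulVec, ← hHdef] at h1
    have h2 : 0 ≤ ∑ j : latticeBox d N,
        if i.1 - j.1 ∈ bandSteps d W then a i j * landscape H j else 0 :=
      Finset.sum_nonneg fun j _ => by
        split_ifs
        exacts [mul_nonneg (ha i j).1 (hu0 j), le_rfl]
    exact pos_of_mul_pos_right (show 0 < (bandDegree d W : ℝ) * landscape H i by linarith)
      (Nat.cast_nonneg _)
  have hl : 0 ≤ groundStateEnergy H := by
    obtain ⟨v, hv⟩ := hleast.1.exists_hasEigenvector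
    have hvH : H.mulVec v = groundStateEnergy H • v := by
      have := hv.apply_eq_smul
      rwa [Matrix.toLin'_apply] at this
    have hvv : 0 < v ⬝ᵥ v := by
      refine lt_of_le_of_ne (Finset.sum_nonneg fun i _ => mul_self_nonneg _) fun h => hv.2 ?_
      exact dotProduct_self_eq_zero.1 h.symm
    -- Writing the ground state as `u χ` with `χ = v / u` displays its energy as a sum of
    -- nonnegative terms.
    have h := dotProduct_mulVec_mul_eq (bandMatrix_comm (W := W) ha') (landscape H)
      fun i => v i / landscape H i
    have e : (fun i => landscape H i * (v i / landscape H i)) = v :=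
      funext fun i => mul_div_cancel₀ _ (hpos i).ne'
    rw [← hHdef, e, hvH, dotProduct_smul, smul_eq_mul, hu] at h
    refine nonneg_of_mul_nonneg_left ?_ hvv
    rw [h]
    refine add_nonneg (Finset.sum_nonneg fun i _ => ?_) (div_nonneg (Finset.sum_nonneg fun i _ =>
      Finset.sum_nonneg fun j _ => ?_) zero_le_two)
    · have := hpos i
      positivity
    · by_cases hij : i = j
      · subst hij; simp
      · refine mul_nonneg ?_ (mul_nonneg (mul_nonneg (hpos i).le (hpos j).le) (sq_nonneg _))
        rw [hHdef, bandMatrix_apply, if_neg hij, zero_sub, neg_neg]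
        split_ifs
        exacts [(ha i j).1, le_rfl]
  refine ⟨hleast, hdet, hpos, ?_, groundStateEnergy_mul_norm_le ha ha' hpos hu hl⟩
  have := one_le_abs_mul_norm_landscape hmin hleast.1
  rwa [abs_of_nonneg hl] at this
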